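/- Let $L\ge 1$ and let $X_1,\dots,X_L$ be independent real random variables such that $X_i$ follows the Pearson type III distribution with parameters $(a_i,b_i,m_i)$, where $a_i$ is a positive integer, $b_i,m_i\in\mathbb R$, and either $b_i>0$ for all $i$ or $b_i<0$ for all $i$. That is, $X_i$ has density $\frac{|b_i|}{\Gamma(a_i)}\,(b_i(x-m_i))^{a_i-1}e^{-b_i(x-m_i)}$ on $(m_i,\infty)$ if $b_i>0$, on $(-\infty,m_i)$ if $b_i<0$, and $0$ elsewhere. Put $SX_L=\sum_{i=1}^L X_i$, $SY_L=e^{SX_L}$, $sa_L=\sum_i a_i$, $sm_L=\sum_i m_i$. For $a>0$, $b\ne0$, $m\in\mathbb R$ let the log Pearson type III range be $(e^m,\infty)$ if $b>0$ and $(0,e^m)$ if $b<0$. For $y$ in this range put $$f_Y(y,a,b,m)=\frac{|b|e^{bm}}{\Gamma(a)}(b(\ln y-m))^{a-1}y^{-b-1},\qquad F_Y(y,a,b,m)=\begin{cases}\frac{1}{\Gamma(a)}\gamma(a,b(\ln y-m)),& b>0,\\ \frac1{\Gamma(a)}\Gamma(a,b(\ln y-m)),& b<0,\end{cases}$$ where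 $\gamma(s,x)=\int_0^x t^{s-1}e^{-t}dt$ and $\Gamma(s,x)=\int_x^\infty t^{s-1}e^{-t}dt$. Outside the range $f_Y=0$, while $F_Y=0$ to the left of the range and $F_Y=1$ to the right of it. Put also $$\mu_Y^n(a,b,m)=e^{mn}\Big(\frac{b}{b-n}\Big)^a .$$ For pairwise distinct rates $b_1,\dots,b_L$, $1\le i\le L$ and $1\le k\le a_i$, let $w_1<\dots<w_{L-1}$ be the elements of $\{1,\dots,L\}\setminus\{i\}$ and define $$\Xi_L^0(i,k)=\sum_{a_i=j_0\ge j_1\ge\cdots\ge j_{L-2}\ge j_{L-1}=k}(-1)^{sa_L-a_i}\,\frac{\prod_{w=1}^L b_w^{a_w}}{b_i^k}\prod_{s=1}^{L-1}\frac{(j_{s-1}+a_{w_s}-j_s-1)!}{(a_{w_s}-1)!\,(j_{s-1}-j_s)!}\,(b_i-b_{w_s})^{j_s-j_{s-1}-a_{w_s}},$$ the sum being over integers $j_1,\dots,j_{L-2}$. (For $L=2$ it has a single term. For $L=1$ the condition reads $a_i=j_0=k$, so that $\Xi_1^0(1,k)$ is $1$ if $k=a_1$ and $0$ otherwise.) Then,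 for every integer $n\ge 0$, the $n$-th moment of $SY_L$ is finite if all $b_i<0$; if all $b_i>0$, it is finite if and only if $b_i>n$ for all $i$. Moreover: 1. If $b_i=b$ for all $i$, then the CDF of $SY_L$ is $F_{SY_L}(y)=F_Y(y,sa_L,b,sm_L)$ for all $y\in\mathbb R$, the function $f_Y(\cdot,sa_L,b,sm_L)$ is a PDF of $SY_L$, and $E[SY_L^n]=\mu_Y^n(sa_L,b,sm_L)$ for every integer $n\ge0$ such that $b<0$ or $b>n$. 2. If $b_i\neq b_j$ for all $i\neq j$, then $$F_{SY_L}(y)=\sum_{i=1}^L\sum_{k=1}^{a_i}\Xi_L^0(i,k)\,F_Y(y,k,b_i,sm_L)\quad\text{for all }y\in\mathbb R,$$ the function $y\mapsto\sum_{i=1}^L\sum_{k=1}^{a_i}\Xi_L^0(i,k)\,f_Y(y,k,b_i,sm_L)$ is nonnegative and is a PDF of $SY_L$, and $$E[SY_L^n]=\sum_{i=1}^L\sum_{k=1}^{a_i}\Xi_L^0(i,k)\,\mu_Y^n(k,b_i,sm_L)$$ for every integer $n\ge0$ such that all $b_i<0$ or all $b_i>n$. -/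

import Mathlib

open MeasureTheory ProbabilityTheory

noncomputable section

/-- The lower incomplete gamma function `γ(s, x) = ∫₀ˣ t ^ (s - 1) e ^ (-t) dt`. -/
def lowerIncGamma (s x : ℝ) : ℝ :=
  ∫ t in Set.Ioc 0 x, t ^ (s - 1) * Real.exp (-t)

/-- The upper incomplete gamma function `Γ(s, x) = ∫ₓ^∞ t ^ (s - 1) e ^ (-t) dt`. -/
def upperIncGamma (s x : ℝ) : ℝ :=
  ∫ t in Set.Ioi x, t ^ (s - 1) * Real.exp (-t)

/-- The range of a Pearson type III variable: `(m, ∞)` if `b > 0`, `(-∞, m)` if `b < 0`. -/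
def pearsonIIIRange (b m : ℝ) : Set ℝ :=
  if 0 < b then Set.Ioi m else Set.Iio m

/-- The Pearson type III density with shape `a`, inverse scale `b` and shift `m`
(zero outside the range). -/
def pearsonIIIPDF (a b m : ℝ) : ℝ → ℝ :=
  (pearsonIIIRange b m).indicator fun x =>
    |b| / Real.Gamma a * (b * (x - m)) ^ (a - 1) * Real.exp (-(b * (x - m)))

/-- The Pearson type III distribution (meant for `0 < a` and `b ≠ 0`). -/
def pearsonIIIMeasure (a b m : ℝ) : Measure ℝ :=
  volume.withDensity fun x => ENNReal.ofReal (pearsonIIIPDF a b m x)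

/-- The range of a log Pearson type III variable:
`(e ^ m, ∞)` if `b > 0`, `(0, e ^ m)` if `b < 0`. -/
def logPearsonIIIRange (b m : ℝ) : Set ℝ :=
  if 0 < b then Set.Ioi (Real.exp m) else Set.Ioo 0 (Real.exp m)

/-- The log Pearson type III density `f_Y(y, a, b, m)` (zero outside the range). -/
def logPearsonIIIPDF (a b m : ℝ) : ℝ → ℝ :=
  (logPearsonIIIRange b m).indicator fun y =>
    |b| * Real.exp (b * m) / Real.Gamma a * (b * (Real.log y - m)) ^ (a - 1) * y ^ (-b - 1)

open Classical in
/-- The log Pearson type III distribution function `F_Y(y, a, b, m)`: the incomplete gamma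
expressions on the range, `0` to the left of the range and `1` to the right of it. -/
def logPearsonIIICDF (a b m y : ℝ) : ℝ :=
  if y ∈ logPearsonIIIRange b m then
    if 0 < b then lowerIncGamma a (b * (Real.log y - m)) / Real.Gamma a
    else upperIncGamma a (b * (Real.log y - m)) / Real.Gamma a
  else if 0 < b then 0
  else if y ≤ 0 then 0 else 1

/-- The closed form `e ^ (m n) (b / (b - n)) ^ a` of the `n`-th log Pearson type III moment
(for `b < 0` or `b > n`). -/
def logPearsonIIIMoment (n : ℕ) (a b m : ℝ) : ℝ :=
  Real.exp (m * n) * (b / (b - n)) ^ a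

/-- `f` is a probability density function of the real random variable `Z`. -/
structure IsDensityOf {Ω : Type*} [MeasurableSpace Ω] (f : ℝ → ℝ) (Z : Ω → ℝ) (P : Measure Ω) :
    Prop where
  measurable : Measurable f
  nonneg : ∀ y, 0 ≤ f y
  hasLaw : HasLaw Z (volume.withDensity fun y => ENNReal.ofReal (f y)) P

/-- The summation indices of the nested sum
`∑_{j₁ = k}^{A} ∑_{j₂ = k}^{j₁} ⋯ ∑_{j_{L-2} = k}^{j_{L-3}}` for `L = N + 1`, completed by the
boundary values `j₀ = A` and `j_{L-1} = k`: the chains `A = j₀ ≥ j₁ ≥ ⋯ ≥ j_N = k`. -/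
def xiChains (N A k : ℕ) : Finset (Fin (N + 1) → ℕ) :=
  (Fintype.piFinset fun _ => Finset.Icc k A).filter fun j =>
    j 0 = A ∧ j (Fin.last N) = k ∧ ∀ s : Fin N, j s.succ ≤ j s.castSucc

/-- The weights `Ξ_L⁰(i, k, {a_q}, {b_q})` for `L = N + 1` summands. With the boundary values
`j₀ = a_i`, `j_{L-1} = k`, the first, the last and the middle factors of each summand all have the
same form. The index `i.succAbove s` runs through the indices different from `i` in increasing
order; it is `s + U(s - i)` in the notation with the Heaviside step function `U`. -/
def Xi0 {N : ℕ} (i : Fin (N + 1)) (k : ℕ) (a : Fin (N + 1) → ℕ) (b : Fin (N + 1) → ℝ) : ℝ :=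
  ∑ j ∈ xiChains N (a i) k,
    (-1) ^ ((∑ q, a q) - a i) * ((∏ w, b w ^ a w) / b i ^ k) *
      ∏ s : Fin N,
        (((j s.castSucc + a (i.succAbove s) - j s.succ - 1).factorial : ℝ) /
            ((a (i.succAbove s) - 1).factorial * (j s.castSucc - j s.succ).factorial)) *
          (b i - b (i.succAbove s)) ^
            ((j s.succ : ℤ) - (j s.castSucc : ℤ) - (a (i.succAbove s) : ℤ))

end

/-!
Centring and scaling reduce a Pearson type III variable to a Gamma variable, so the characteristic
function of `∑ i, X i` is `e ^ (i t ∑ m)` times `∏ i, (b i / (b i - i t)) ^ a i`. For equal rates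
this is again of Pearson type III, with shape `∑ i, a i`. For distinct rates the product is
decomposed into partial fractions: the numerator over `(b i - z) ^ a i` is the power series of the
other factors in `b i - z`, truncated at order `a i`, and the weights `Xi0 i k a b` are its
coefficients, the chains in their definition enumerating the terms of the product of the series
`(X - (b i - b j)) ^ (-a j)`. By uniqueness of characteristic functions, the law of `SY` is then a
signed mixture of log Pearson type III laws, and integrating indicators and powers against it gives
the distribution function and the moments. The mixture of the densities represents the law of `SY`,
hence is nonnegative almost everywhere; it is nonnegative everywhere because it vanishes at `0` and
at `e ^ ∑ m` and is continuous at all other points.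
-/

section Chains

variable {N : ℕ}

theorem mem_xiChains {A k : ℕ} {j : Fin (N + 1) → ℕ} :
    j ∈ xiChains N A k ↔ j 0 = A ∧ j (Fin.last N) = k ∧ ∀ s : Fin N, j s.succ ≤ j s.castSucc := by
  simp only [xiChains, Finset.mem_filter, Fintype.mem_piFinset, Finset.mem_Icc,
    and_iff_right_iff_imp]
  rintro ⟨rfl, rfl, hj⟩ s
  have hanti : Antitone j := Fin.antitone_iff_succ_le.2 hj
  exact ⟨hanti (Fin.le_last s), hanti (Fin.zero_le s)⟩

theorem le_of_mem_xiChains {A k : ℕ} {j : Fin (N + 1) → ℕ} (hj : j ∈ xiChains N A k) : k ≤ A := by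
  obtain ⟨rfl, rfl, hstep⟩ := mem_xiChains.1 hj
  exact Fin.antitone_iff_succ_le.2 hstep (Fin.zero_le _)

theorem cons_mem_xiChains {A B k : ℕ} {j : Fin (N + 1) → ℕ} :
    Fin.cons B j ∈ xiChains (N + 1) A k ↔ B = A ∧ j 0 ≤ A ∧ j ∈ xiChains N (j 0) k := by
  simp only [mem_xiChains, Fin.forall_fin_succ (n := N), Fin.cons_zero, Fin.cons_succ,
    ← Fin.succ_last, Fin.castSucc_zero, ← Fin.succ_castSucc, true_and]
  refine and_congr_right ?_
  rintro rfl
  exact and_left_comm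

theorem sum_xiChains_succ {M : Type*} [AddCommMonoid M] (A k : ℕ) (F : (Fin (N + 2) → ℕ) → M) :
    ∑ j ∈ xiChains (N + 1) A k, F j =
      ∑ B ∈ Finset.Icc k A, ∑ j ∈ xiChains N B k, F (Fin.cons A j) := by
  rw [Finset.sum_sigma']
  refine (Finset.sum_bij' (fun x _ => Fin.cons A x.2) (fun j _ => ⟨j 1, Fin.tail j⟩)
    ?_ ?_ ?_ ?_ fun _ _ => rfl).symm
  · rintro ⟨B, j⟩ hj
    simp only [Finset.mem_sigma, Finset.mem_Icc] at hj
    obtain rfl := (mem_xiChains.1 hj.2).1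
    exact cons_mem_xiChains.2 ⟨rfl, hj.1.2, hj.2⟩
  · intro j hj
    rw [← Fin.cons_self_tail j, cons_mem_xiChains] at hj
    exact Finset.mem_sigma.2 ⟨Finset.mem_Icc.2 ⟨le_of_mem_xiChains hj.2.2, hj.2.1⟩, hj.2.2⟩
  · rintro ⟨B, j⟩ hj
    simp only [Finset.mem_sigma] at hj
    obtain rfl := (mem_xiChains.1 hj.2).1
    rfl
  · intro j hj
    obtain rfl := (mem_xiChains.1 hj).1
    exact Fin.cons_self_tail j

theorem sum_Icc_eq_sum_antidiagonal {M : Type*} [AddCommMonoid M] {k A : ℕ} (hk : k ≤ A)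
    (F : ℕ → ℕ → M) :
    ∑ B ∈ Finset.Icc k A, F (A - B) (B - k) =
      ∑ p ∈ Finset.HasAntidiagonal.antidiagonal (A - k), F p.1 p.2 := by
  refine Finset.sum_bij' (fun B _ => (A - B, B - k)) (fun p _ => p.2 + k) ?_ ?_ ?_ ?_
    fun _ _ => rfl
  all_goals
    simp only [Finset.mem_Icc, Finset.HasAntidiagonal.mem_antidiagonal, Prod.forall, Prod.mk.injEq]
    omega

theorem xiChains_zero (A k : ℕ) : xiChains 0 A k = if A = k then {fun _ => A} else ∅ := by
  ext j
  rw [mem_xiChains]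
  split_ifs with h
  · simp [h, funext_iff, Fin.forall_fin_one]
  · simp only [Finset.notMem_empty, iff_false]
    rintro ⟨rfl, rfl, -⟩
    exact h rfl

-- The drops `j s - j (s + 1)` of a chain from `A` to `k` are the degrees, summing to `A - k`, of
-- the terms picked from the factors when the product is expanded.
theorem sum_xiChains_prod {R : Type*} [CommSemiring R] (f : Fin N → PowerSeries R) {A k : ℕ}
    (hk : k ≤ A) :
    ∑ j ∈ xiChains N A k, ∏ s : Fin N, PowerSeries.coeff (j s.castSucc - j s.succ) (f s) =
      PowerSeries.coeff (A - k) (∏ s, f s) := by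
  induction N generalizing A with
  | zero =>
    rw [xiChains_zero, Finset.univ_eq_empty, Finset.prod_empty, PowerSeries.coeff_one]
    simp only [Nat.sub_eq_zero_iff_le, Finset.prod_empty]
    split_ifs <;> first | omega | simp
  | succ N ih =>
    rw [sum_xiChains_succ, Fin.prod_univ_succ, PowerSeries.coeff_mul,
      ← sum_Icc_eq_sum_antidiagonal hk (fun p q => PowerSeries.coeff p (f 0) *
        PowerSeries.coeff q (∏ s : Fin N, f s.succ))]
    refine Finset.sum_congr rfl fun B hB => ?_
    rw [← ih (fun s => f s.succ) (Finset.mem_Icc.1 hB).1, Finset.mul_sum]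
    refine Finset.sum_congr rfl fun j hj => ?_
    rw [Fin.prod_univ_succ]
    simp only [Fin.castSucc_zero, Fin.cons_zero, Fin.cons_succ, ← Fin.succ_castSucc,
      (mem_xiChains.1 hj).1]

end Chains

section PowerSeries

theorem coeff_inv_X_sub_C_pow {K : Type*} [Field K] [CharZero K] {d : K} (hd : d ≠ 0) {a : ℕ}
    (ha : 0 < a) (n : ℕ) :
    PowerSeries.coeff n ((PowerSeries.X - PowerSeries.C d) ^ a)⁻¹ =
      (-1) ^ a * (((n + a - 1).factorial : K) / ((a - 1).factorial * n.factorial) *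
        d ^ (-(n : ℤ) - (a : ℤ))) := by
  obtain ⟨c, rfl⟩ := Nat.exists_eq_add_of_le' ha
  have hfactor : (PowerSeries.X - PowerSeries.C d : PowerSeries K) =
      PowerSeries.C (-d) * PowerSeries.rescale d⁻¹ (1 - PowerSeries.X) := by
    rw [map_sub, map_one, PowerSeries.rescale_X, mul_sub, ← mul_assoc, ← map_mul]
    simp only [mul_one, neg_mul, ne_eq, hd, not_false_eq_true, mul_inv_cancel₀, map_neg, map_one]
    ring
  have hinv : ((PowerSeries.X - PowerSeries.C d : PowerSeries K) ^ (c + 1))⁻¹ =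
      PowerSeries.C ((-d)⁻¹ ^ (c + 1)) *
        PowerSeries.rescale d⁻¹ (PowerSeries.mk fun n => ((c + n).choose c : K)) := by
    rw [eq_comm, PowerSeries.eq_inv_iff_mul_eq_one (by simpa using hd), hfactor, mul_pow,
      ← map_pow, mul_mul_mul_comm, ← map_mul, ← mul_pow, inv_mul_cancel₀ (neg_ne_zero.2 hd),
      ← map_pow, ← map_mul, PowerSeries.mk_add_choose_mul_one_sub_pow_eq_one]
    simp
  rw [hinv, PowerSeries.coeff_C_mul, PowerSeries.coeff_rescale, PowerSeries.coeff_mk,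
    Nat.cast_add_choose, zpow_sub₀ hd, zpow_neg, zpow_natCast, zpow_natCast, inv_pow, inv_pow,
    neg_pow d, mul_inv, ← inv_pow (-1 : K), inv_neg_one, Nat.add_sub_cancel,
    show n + (c + 1) - 1 = c + n by omega]
  ring

theorem prod_compl_singleton_eq_prod_succAbove {M : Type*} [CommMonoid M] {N : ℕ}
    (i : Fin (N + 1)) (f : Fin (N + 1) → M) :
    ∏ j ∈ {i}ᶜ, f j = ∏ s, f (i.succAbove s) := by
  rw [← Fin.image_succAbove_univ, Finset.prod_image Fin.succAbove_right_injective.injOn]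

theorem Xi0_eq_coeff {N : ℕ} {a : Fin (N + 1) → ℕ} {b : Fin (N + 1) → ℝ} (ha : ∀ i, 0 < a i)
    (hb : Function.Injective b) {i : Fin (N + 1)} {k : ℕ} (hk : k ≤ a i) :
    Xi0 i k a b = (∏ w, b w ^ a w) / b i ^ k * PowerSeries.coeff (a i - k)
      (∏ j ∈ {i}ᶜ, ((PowerSeries.X - PowerSeries.C (b i - b j)) ^ a j)⁻¹) := by
  have hexp : (∑ q, a q) - a i = ∑ s, a (i.succAbove s) := by
    rw [Fin.sum_univ_succAbove _ i, Nat.add_sub_cancel_left]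
  rw [prod_compl_singleton_eq_prod_succAbove, ← sum_xiChains_prod _ hk, Finset.mul_sum, Xi0, hexp,
    ← Finset.prod_pow_eq_pow_sum]
  refine Finset.sum_congr rfl fun j hj => ?_
  rw [mul_right_comm, mul_comm, ← Finset.prod_mul_distrib]
  refine congrArg₂ _ rfl (Finset.prod_congr rfl fun s _ => ?_)
  have hstep := (mem_xiChains.1 hj).2.2 s
  have hapos := ha (i.succAbove s)
  rw [coeff_inv_X_sub_C_pow (sub_ne_zero.2 (hb.ne (Fin.succAbove_ne i s).symm)) hapos,
    show j s.castSucc + a (i.succAbove s) - j s.succ - 1 =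
      j s.castSucc - j s.succ + a (i.succAbove s) - 1 by omega,
    show (j s.succ : ℤ) - j s.castSucc - a (i.succAbove s) =
      -((j s.castSucc - j s.succ : ℕ) : ℤ) - a (i.succAbove s) by omega]

end PowerSeries

section PartialFractions

open Polynomial

theorem X_pow_dvd_trunc_mul_sub_one {R : Type*} [CommRing R] {g : PowerSeries R} {p : R[X]}
    (h : g * p = 1) (n : ℕ) : X ^ n ∣ PowerSeries.trunc n g * p - 1 := by
  refine X_pow_dvd_iff.2 fun d hd => ?_
  rw [← coeff_coe, coe_sub, coe_mul, coe_one, map_sub, ← h,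
    PowerSeries.coeff_mul_eq_coeff_trunc_mul_trunc g p hd,
    PowerSeries.coeff_mul_eq_coeff_trunc_mul_trunc _ (p : PowerSeries R) hd,
    PowerSeries.trunc_trunc, sub_self]

theorem sum_mul_prod_compl_eq_one {K ι : Type*} [Field K] [Fintype ι] [DecidableEq ι] [Nonempty ι]
    {p q : ι → K[X]} (hcop : Pairwise (Function.onFun IsCoprime q))
    (hdeg : ∀ i, (p i).natDegree < (q i).natDegree)
    (hdvd : ∀ i, q i ∣ p i * ∏ j ∈ {i}ᶜ, q j - 1) :
    ∑ i, p i * ∏ j ∈ {i}ᶜ, q j = 1 := by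
  have hne (i : ι) : q i ≠ 0 := ne_zero_of_natDegree_gt (hdeg i)
  rw [← sub_eq_zero]
  refine eq_zero_of_dvd_of_natDegree_lt (p := ∏ i, q i) ?_ ?_
  · refine Finset.prod_dvd_of_coprime (hcop.set_pairwise _) fun i _ => ?_
    rw [Fintype.sum_eq_add_sum_compl i, add_sub_right_comm]
    refine dvd_add (hdvd i) (Finset.dvd_sum fun t ht => Dvd.dvd.mul_left ?_ _)
    refine Finset.dvd_prod_of_mem q ?_
    simpa [eq_comm] using ht
  · have hpos : 0 < ∑ i, (q i).natDegree :=
      Finset.sum_pos (fun i _ => (Nat.zero_le _).trans_lt (hdeg i)) Finset.univ_nonempty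
    rw [natDegree_prod _ _ fun i _ => hne i]
    refine (natDegree_sub_le _ _).trans_lt (max_lt ?_ (by rwa [natDegree_one]))
    refine (natDegree_sum_le_of_forall_le (n := ∑ i, (q i).natDegree - 1) _ _
      fun i _ => natDegree_mul_le.trans ?_).trans_lt (by omega)
    rw [natDegree_prod _ _ fun j _ => hne j, Fintype.sum_eq_add_sum_compl i]
    have := hdeg i
    omega

variable {K ι : Type*} [Field K] [Fintype ι] [DecidableEq ι]

theorem natDegree_C_sub_X (c : K) : (C c - X : K[X]).natDegree = 1 := by
  rw [← neg_sub, natDegree_neg, natDegree_X_sub_C]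

/-- The numerator over `(b i - X) ^ a i` in the partial fraction decomposition of
`∏ j, (b j - X) ^ (-a j)`: the expansion of the other factors in powers of `b i - X`, truncated
at order `a i`. -/
noncomputable def partialFractionNumerator (a : ι → ℕ) (b : ι → K) (i : ι) : K[X] :=
  (PowerSeries.trunc (a i) (∏ j ∈ {i}ᶜ,
    ((PowerSeries.X - PowerSeries.C (b i - b j)) ^ a j)⁻¹)).comp (C (b i) - X)

theorem natDegree_partialFractionNumerator_lt {a : ι → ℕ} (b : ι → K) {i : ι} (hi : 0 < a i) :
    (partialFractionNumerator a b i).natDegree < a i := by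
  rw [partialFractionNumerator, natDegree_comp, natDegree_C_sub_X, mul_one]
  obtain ⟨c, hc⟩ := Nat.exists_eq_add_of_le' hi
  exact hc ▸ PowerSeries.natDegree_trunc_lt _ _

theorem pow_dvd_partialFractionNumerator_mul_sub_one (a : ι → ℕ) {b : ι → K}
    (hb : Function.Injective b) (i : ι) :
    (C (b i) - X) ^ a i ∣
      partialFractionNumerator a b i * ∏ j ∈ {i}ᶜ, (C (b j) - X) ^ a j - 1 := by
  have hinv : (∏ j ∈ {i}ᶜ, ((PowerSeries.X - PowerSeries.C (b i - b j)) ^ a j)⁻¹) *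
      ((∏ j ∈ {i}ᶜ, (X - C (b i - b j)) ^ a j : K[X]) : PowerSeries K) = 1 := by
    rw [← coeToPowerSeries.ringHom_apply, map_prod, ← Finset.prod_mul_distrib]
    refine Finset.prod_eq_one fun j hj => ?_
    have hij : b j - b i ≠ 0 := sub_ne_zero.2 (hb.ne (by simpa using hj))
    rw [coeToPowerSeries.ringHom_apply, coe_pow, coe_sub, coe_X, coe_C]
    exact PowerSeries.inv_mul_cancel _ (by simp [hij])
  have hdvd := map_dvd (compRingHom (C (b i) - X)) (X_pow_dvd_trunc_mul_sub_one hinv (a i))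
  simpa only [partialFractionNumerator, coe_compRingHom_apply, sub_comp, mul_comp, one_comp,
    pow_comp, X_comp, prod_comp, C_comp, C_sub, sub_sub_sub_cancel_left] using hdvd

theorem sum_partialFractionNumerator_mul [Nonempty ι] {a : ι → ℕ} (ha : ∀ i, 0 < a i) {b : ι → K}
    (hb : Function.Injective b) :
    ∑ i, partialFractionNumerator a b i * ∏ j ∈ {i}ᶜ, (C (b j) - X) ^ a j = 1 := by
  refine sum_mul_prod_compl_eq_one (q := fun j => (C (b j) - X) ^ a j) (fun i j hij => ?_)
    (fun i => ?_) fun i => pow_dvd_partialFractionNumerator_mul_sub_one a hb i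
  · have hcop := (pairwise_coprime_X_sub_C hb hij).neg_neg
    simp only [neg_sub] at hcop
    exact hcop.pow
  · rw [natDegree_pow, natDegree_C_sub_X, mul_one]
    exact natDegree_partialFractionNumerator_lt b (ha i)

theorem aeval_partialFractionNumerator {F : Type*} [Field F] [Algebra ℝ F] {N : ℕ}
    {a : Fin (N + 1) → ℕ} {b : Fin (N + 1) → ℝ} (ha : ∀ i, 0 < a i) (hb : ∀ i, b i ≠ 0)
    (hinj : Function.Injective b) (i : Fin (N + 1)) {z : F} (hz : algebraMap ℝ F (b i) ≠ z) :
    (∏ w, algebraMap ℝ F (b w) ^ a w) / (algebraMap ℝ F (b i) - z) ^ a i *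
      aeval z (partialFractionNumerator a b i) =
    ∑ k ∈ Finset.Icc 1 (a i), algebraMap ℝ F (Xi0 i k a b) *
      (algebraMap ℝ F (b i) / (algebraMap ℝ F (b i) - z)) ^ k := by
  have hz' := sub_ne_zero.2 hz
  have hb' : algebraMap ℝ F (b i) ≠ 0 := by simpa using hb i
  rw [partialFractionNumerator, aeval_comp, map_sub, aeval_C, aeval_X, aeval_def,
    PowerSeries.eval₂_trunc_eq_sum_range, Finset.mul_sum]
  refine Finset.sum_bij' (fun l _ => a i - l) (fun k _ => a i - k) ?_ ?_ ?_ ?_ fun l hl => ?_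
  · simp only [Finset.mem_range, Finset.mem_Icc]
    omega
  · have := ha i
    simp only [Finset.mem_range, Finset.mem_Icc]
    omega
  · simp only [Finset.mem_range]
    omega
  · simp only [Finset.mem_Icc]
    omega
  · rw [Finset.mem_range] at hl
    rw [Xi0_eq_coeff ha hinj (Nat.sub_le _ _), Nat.sub_sub_self hl.le, map_mul, map_div₀,
      map_prod (algebraMap ℝ F), div_pow, pow_sub₀ _ hz' hl.le]
    simp only [map_pow]
    field_simp

theorem prod_div_sub_pow_eq_sum_Xi0 {F : Type*} [Field F] [Algebra ℝ F] {N : ℕ}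
    {a : Fin (N + 1) → ℕ} {b : Fin (N + 1) → ℝ} (ha : ∀ i, 0 < a i) (hb : ∀ i, b i ≠ 0)
    (hinj : Function.Injective b) {z : F} (hz : ∀ i, algebraMap ℝ F (b i) ≠ z) :
    ∏ i, (algebraMap ℝ F (b i) / (algebraMap ℝ F (b i) - z)) ^ a i =
      ∑ i, ∑ k ∈ Finset.Icc 1 (a i), algebraMap ℝ F (Xi0 i k a b) *
        (algebraMap ℝ F (b i) / (algebraMap ℝ F (b i) - z)) ^ k := by
  have hone := congrArg (aeval z) (sum_partialFractionNumerator_mul ha hinj)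
  simp only [map_sum, map_mul, map_prod, map_pow, map_sub, aeval_C, aeval_X, map_one] at hone
  simp_rw [← aeval_partialFractionNumerator ha hb hinj _ (hz _), div_pow]
  rw [Finset.prod_div_distrib, ← mul_one (_ / _), ← hone, Finset.mul_sum]
  refine Finset.sum_congr rfl fun i _ => ?_
  have hne (j : Fin (N + 1)) : algebraMap ℝ F (b j) - z ≠ 0 := sub_ne_zero.2 (hz j)
  have hcompl : ∏ j ∈ {i}ᶜ, (algebraMap ℝ F (b j) - z) ^ a j ≠ 0 :=
    Finset.prod_ne_zero_iff.2 fun j _ => pow_ne_zero _ (hne j)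
  rw [Fintype.prod_eq_mul_prod_compl i fun w => (algebraMap ℝ F (b w) - z) ^ a w]
  have := hne i
  field_simp

end PartialFractions

section GammaDistribution

theorem eqOn_complexMGF_of_analyticOnNhd {Ω : Type*} [MeasurableSpace Ω] {X : Ω → ℝ}
    {μ : Measure Ω} {g : ℂ → ℂ}
    (hg : AnalyticOnNhd ℂ g {z | z.re ∈ interior (integrableExpSet X μ)})
    (hmgf : ∀ t ∈ interior (integrableExpSet X μ), (mgf X μ t : ℂ) = g t) :
    Set.EqOn (complexMGF X μ) g {z | z.re ∈ interior (integrableExpSet X μ)} := by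
  intro z hz
  refine AnalyticOnNhd.eqOn_of_preconnected_of_frequently_eq analyticOnNhd_complexMGF hg
    (convex_integrableExpSet.interior.linear_preimage Complex.reLm).isPreconnected
    (z₀ := (z.re : ℂ)) hz ?_ hz
  have hreal : Filter.Tendsto ((↑) : ℝ → ℂ) (nhdsWithin z.re {z.re}ᶜ)
      (nhdsWithin (z.re : ℂ) {(z.re : ℂ)}ᶜ) :=
    Complex.continuous_ofReal.continuousWithinAt.tendsto_nhdsWithin fun x hx => by simpa using hx
  refine hreal.frequently (Filter.Eventually.frequently ?_)
  filter_upwards [mem_nhdsWithin_of_mem_nhds (isOpen_interior.mem_nhds hz)] with t ht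
  rw [complexMGF_ofReal, hmgf t ht]

theorem gammaMeasure_eq_withDensity_restrict (a r : ℝ) :
    gammaMeasure a r = (volume.restrict (Set.Ioi 0)).withDensity fun t =>
      ENNReal.ofReal (r ^ a / Real.Gamma a * t ^ (a - 1) * Real.exp (-(r * t))) := by
  rw [gammaMeasure, ← withDensity_indicator measurableSet_Ioi]
  refine withDensity_congr_ae ?_
  filter_upwards [compl_mem_ae_iff.2 (measure_singleton (0 : ℝ))] with t ht
  rcases lt_or_gt_of_ne (ht : t ≠ 0) with h | h
  · rw [gammaPDF_of_neg h, Set.indicator_of_notMem (Set.notMem_Ioi.2 h.le)]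
  · rw [gammaPDF_of_nonneg h.le, Set.indicator_of_mem (Set.mem_Ioi.2 h)]

variable {E : Type*} [NormedAddCommGroup E] [NormedSpace ℝ E] {a r : ℝ}

theorem integral_gammaMeasure (ha : 0 < a) (hr : 0 < r) (f : ℝ → E) :
    ∫ t, f t ∂(gammaMeasure a r) =
      ∫ t in Set.Ioi 0, (r ^ a / Real.Gamma a * t ^ (a - 1) * Real.exp (-(r * t))) • f t := by
  rw [gammaMeasure_eq_withDensity_restrict,
    integral_withDensity_eq_integral_toReal_smul (by fun_prop) (by simp)]
  refine setIntegral_congr_fun measurableSet_Ioi fun t (ht : 0 < t) => ?_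
  rw [ENNReal.toReal_ofReal (by positivity)]

theorem integrable_gammaMeasure_iff (ha : 0 < a) (hr : 0 < r) (f : ℝ → E) :
    Integrable f (gammaMeasure a r) ↔ IntegrableOn
      (fun t => (r ^ a / Real.Gamma a * t ^ (a - 1) * Real.exp (-(r * t))) • f t) (Set.Ioi 0) := by
  rw [gammaMeasure_eq_withDensity_restrict,
    integrable_withDensity_iff_integrable_smul' (by fun_prop) (by simp)]
  refine integrableOn_congr_fun (fun t (ht : 0 < t) => ?_) measurableSet_Ioi
  rw [ENNReal.toReal_ofReal (by positivity)]

theorem gammaDensity_mul_exp (a r c t : ℝ) :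
    r ^ a / Real.Gamma a * t ^ (a - 1) * Real.exp (-(r * t)) * Real.exp (c * t) =
      r ^ a / Real.Gamma a * (t ^ (a - 1) * Real.exp (-((r - c) * t))) := by
  rw [mul_assoc _ (Real.exp _), ← Real.exp_add, mul_assoc]
  ring_nf

theorem integrable_exp_mul_gammaMeasure_iff_integrableOn (ha : 0 < a) (hr : 0 < r) (c : ℝ) :
    Integrable (fun t => Real.exp (c * t)) (gammaMeasure a r) ↔
      IntegrableOn (fun t => t ^ (a - 1) * Real.exp (-((r - c) * t))) (Set.Ioi 0) := by
  have hconst : r ^ a / Real.Gamma a ≠ 0 := by positivity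
  simp only [integrable_gammaMeasure_iff ha hr, smul_eq_mul, gammaDensity_mul_exp]
  exact integrable_const_mul_iff hconst.isUnit _

theorem integrableExpSet_id_gammaMeasure (ha : 0 < a) (hr : 0 < r) :
    integrableExpSet id (gammaMeasure a r) = Set.Iio r := by
  have := isProbabilityMeasure_gammaMeasure ha hr
  refine Set.Subset.antisymm (fun c hc => ?_) fun c (hc : c < r) => ?_
  · by_contra! hrc
    have hr_mem : r ∈ integrableExpSet id (gammaMeasure a r) :=
      integrable_exp_mul_of_nonneg_of_le hc hr.le (by simpa using hrc)
    have hpow := (integrable_exp_mul_gammaMeasure_iff_integrableOn ha hr r).1 hr_mem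
    simp only [sub_self, zero_mul, neg_zero, Real.exp_zero, mul_one] at hpow
    exact not_integrableOn_Ioi_rpow _ hpow
  · refine (integrable_exp_mul_gammaMeasure_iff_integrableOn ha hr c).2 ?_
    simpa only [Real.rpow_one, neg_mul] using
      integrableOn_rpow_mul_exp_neg_mul_rpow (s := a - 1) (by linarith) zero_lt_one (sub_pos.2 hc)

theorem mgf_id_gammaMeasure (ha : 0 < a) (hr : 0 < r) {c : ℝ} (hc : c < r) :
    mgf id (gammaMeasure a r) c = (r / (r - c)) ^ a := by
  have hrc := sub_pos.2 hc
  simp only [mgf, id_eq, integral_gammaMeasure ha hr, smul_eq_mul, gammaDensity_mul_exp]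
  rw [integral_const_mul, Real.integral_rpow_mul_exp_neg_mul_Ioi ha hrc,
    Real.div_rpow zero_le_one hrc.le, Real.div_rpow hr.le hrc.le, Real.one_rpow]
  have := (Real.Gamma_pos_of_pos ha).ne'
  field_simp

theorem complexMGF_id_gammaMeasure (ha : 0 < a) (hr : 0 < r) {z : ℂ} (hz : z.re < r) :
    complexMGF id (gammaMeasure a r) z = ((r : ℂ) / (r - z)) ^ (a : ℂ) := by
  have hset := integrableExpSet_id_gammaMeasure ha hr
  refine eqOn_complexMGF_of_analyticOnNhd (X := id)
    (g := fun z => ((r : ℂ) / (r - z)) ^ (a : ℂ)) ?_ ?_ (by simpa [hset])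
  · intro w hw
    have hpos : 0 < ((r : ℂ) - w).re := by simpa [hset] using hw
    have hne : (r : ℂ) - w ≠ 0 := fun h => by simp [h] at hpos
    have hquot : 0 < ((r : ℂ) / (r - w)).re := by
      rw [Complex.div_re, Complex.ofReal_re, Complex.ofReal_im, zero_mul, zero_div, add_zero]
      exact div_pos (mul_pos hr hpos) (Complex.normSq_pos.2 hne)
    exact AnalyticAt.cpow (by fun_prop (disch := exact hne)) analyticAt_const (Or.inl hquot)
  · intro t ht
    rw [hset, interior_Iio] at ht
    rw [mgf_id_gammaMeasure ha hr ht, Complex.ofReal_cpow]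
    · push_cast
      rfl
    · exact div_nonneg hr.le (sub_pos.2 ht).le

theorem measureReal_gammaMeasure_one (ha : 0 < a) {s : Set ℝ} (hs : MeasurableSet s) :
    (gammaMeasure a 1).real s =
      (∫ t in Set.Ioi 0 ∩ s, t ^ (a - 1) * Real.exp (-t)) / Real.Gamma a := by
  rw [← integral_indicator_one hs, integral_gammaMeasure ha one_pos, ← integral_div,
    ← setIntegral_indicator hs]
  refine setIntegral_congr_fun measurableSet_Ioi fun x _ => ?_
  by_cases hx : x ∈ s
  · simp only [Real.one_rpow, one_mul, Set.indicator_of_mem hx, Pi.one_apply, smul_eq_mul, mul_one]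
    ring
  · simp only [Set.indicator_of_notMem hx, smul_zero]

theorem gammaMeasure_one_real_Iic (ha : 0 < a) (x : ℝ) :
    (gammaMeasure a 1).real (Set.Iic x) = lowerIncGamma a x / Real.Gamma a := by
  rw [measureReal_gammaMeasure_one ha measurableSet_Iic, Set.Ioi_inter_Iic, lowerIncGamma]

theorem gammaMeasure_one_real_Ici (ha : 0 < a) (x : ℝ) :
    (gammaMeasure a 1).real (Set.Ici x) = upperIncGamma a (max 0 x) / Real.Gamma a := by
  have hIoi : Set.Ici x =ᵐ[gammaMeasure a 1] Set.Ioi x :=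
    (Ioi_ae_eq_Ici' (withDensity_absolutelyContinuous _ _ (by simp))).symm
  rw [measureReal_congr hIoi, measureReal_gammaMeasure_one ha measurableSet_Ioi,
    Set.Ioi_inter_Ioi, upperIncGamma]

end GammaDistribution

section PearsonIII

theorem map_withDensity_of_hasDerivAt {f f' : ℝ → ℝ} {p g : ℝ → ENNReal}
    (hinj : Function.Injective f) (hf' : ∀ x, HasDerivAt f (f' x) x)
    (hp : p =ᵐ[volume] fun x => ENNReal.ofReal |f' x| * g (f x))
    (hg : ∀ y ∉ Set.range f, g y = 0) :
    (volume.withDensity p).map f = volume.withDensity g := by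
  have hf : Measurable f :=
    (continuous_iff_continuousAt.2 fun x => (hf' x).continuousAt).measurable
  have hrange : MeasurableSet (Set.range f) := (hf.measurableEmbedding hinj).measurableSet_range
  ext s hs
  calc (volume.withDensity p).map f s
      = ∫⁻ x in f ⁻¹' s, ENNReal.ofReal |f' x| * g (f x) := by
        rw [Measure.map_apply hf hs, withDensity_apply _ (hf hs)]
        exact lintegral_congr_ae (ae_restrict_of_ae hp)
    _ = ∫⁻ y in s ∩ Set.range f, g y := by
        rw [← lintegral_image_eq_lintegral_abs_deriv_mul (hf hs)
          (fun x _ => (hf' x).hasDerivWithinAt) hinj.injOn, Set.image_preimage_eq_inter_range]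
    _ = ∫⁻ y in s, g y := by
        rw [Set.inter_comm, ← setLIntegral_indicator hrange, Set.indicator_eq_self.2]
        exact fun y hy => by_contra fun h => hy (hg y h)
    _ = volume.withDensity g s := (withDensity_apply _ hs).symm

variable {a b m : ℝ}

theorem add_div_mem_pearsonIIIRange {t : ℝ} (hb : b ≠ 0) :
    m + t / b ∈ pearsonIIIRange b m ↔ 0 < t := by
  unfold pearsonIIIRange
  split_ifs with h
  · simp [div_pos_iff_of_pos_right h]
  · have h : b < 0 := lt_of_le_of_ne (not_lt.1 h) hb
    simp [div_neg_iff, h, h.not_gt]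

theorem mul_sub_pos_of_mem_pearsonIIIRange {x : ℝ} (hb : b ≠ 0) (hx : x ∈ pearsonIIIRange b m) :
    0 < b * (x - m) := by
  refine (add_div_mem_pearsonIIIRange (m := m) hb).1 ?_
  rwa [mul_div_cancel_left₀ _ hb, add_sub_cancel]

theorem pearsonIIIMeasure_eq_map (hb : b ≠ 0) :
    pearsonIIIMeasure a b m = (gammaMeasure a 1).map fun t => m + t / b := by
  have hinj : Function.Injective fun t => m + t / b := fun x y h => by
    simpa [hb, div_left_inj'] using h
  have hsurj (x : ℝ) : m + b * (x - m) / b = x := by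
    rw [mul_div_cancel_left₀ _ hb, add_sub_cancel]
  have hderiv (x : ℝ) : HasDerivAt (fun t => m + t / b) (1 / b) x :=
    ((hasDerivAt_id x).div_const b).const_add m
  refine (map_withDensity_of_hasDerivAt hinj hderiv ?_ fun y hy => absurd ⟨_, hsurj y⟩ hy).symm
  filter_upwards [compl_mem_ae_iff.2 (measure_singleton (0 : ℝ))] with t ht
  rcases lt_or_gt_of_ne (ht : t ≠ 0) with h | h
  · rw [gammaPDF_of_neg h, pearsonIIIPDF,
      Set.indicator_of_notMem (mt (add_div_mem_pearsonIIIRange hb).1 h.not_gt), ENNReal.ofReal_zero,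
      mul_zero]
  · rw [gammaPDF_of_nonneg h.le, pearsonIIIPDF,
      Set.indicator_of_mem ((add_div_mem_pearsonIIIRange hb).2 h),
      ← ENNReal.ofReal_mul (abs_nonneg _), add_sub_cancel_left, mul_div_cancel₀ _ hb, abs_div,
      abs_one, Real.one_rpow, one_mul, ← mul_assoc, ← mul_assoc, mul_div_assoc',
      one_div_mul_cancel (abs_ne_zero.2 hb)]

theorem isProbabilityMeasure_pearsonIIIMeasure (ha : 0 < a) (hb : b ≠ 0) :
    IsProbabilityMeasure (pearsonIIIMeasure a b m) := by
  have := isProbabilityMeasure_gammaMeasure ha one_pos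
  rw [pearsonIIIMeasure_eq_map hb]
  exact Measure.isProbabilityMeasure_map (by fun_prop)

theorem charFun_pearsonIIIMeasure (ha : 0 < a) (hb : b ≠ 0) (t : ℝ) :
    charFun (pearsonIIIMeasure a b m) t =
      ((b : ℂ) / (b - t * Complex.I)) ^ (a : ℂ) * Complex.exp (t * m * Complex.I) := by
  have haffine : (fun t => m + t / b) = (m + ·) ∘ (b⁻¹ * ·) := by
    ext t
    simp only [Function.comp_apply, div_eq_inv_mul]
  have hb' : (b : ℂ) ≠ 0 := by exact_mod_cast hb
  have hbase : (1 : ℂ) / (1 - (b⁻¹ * t : ℝ) * Complex.I) = b / (b - t * Complex.I) := by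
    rw [← mul_div_mul_left _ _ hb', mul_one, mul_sub, mul_one]
    push_cast
    rw [mul_assoc, mul_inv_cancel_left₀ hb']
  rw [pearsonIIIMeasure_eq_map hb, haffine, ← Measure.map_map (by fun_prop) (by fun_prop),
    charFun_map_const_add, charFun_map_mul, ← complexMGF_id_mul_I,
    complexMGF_id_gammaMeasure ha one_pos (by simp), Complex.ofReal_one, hbase]
  simp [mul_comm]

end PearsonIII

section LogPearsonIII

variable {a b m y : ℝ}

/-- The log Pearson type III distribution, the law of `exp X` for a Pearson type III variable `X`
(meant for `0 < a` and `b ≠ 0`). -/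
noncomputable def logPearsonIIIMeasure (a b m : ℝ) : Measure ℝ :=
  (pearsonIIIMeasure a b m).map Real.exp

theorem isProbabilityMeasure_logPearsonIIIMeasure (ha : 0 < a) (hb : b ≠ 0) :
    IsProbabilityMeasure (logPearsonIIIMeasure a b m) :=
  have := isProbabilityMeasure_pearsonIIIMeasure (m := m) ha hb
  Measure.isProbabilityMeasure_map Real.measurable_exp.aemeasurable

theorem logPearsonIIIMeasure_eq_map (hb : b ≠ 0) :
    logPearsonIIIMeasure a b m = (gammaMeasure a 1).map fun t => Real.exp (m + t / b) := by
  rw [logPearsonIIIMeasure, pearsonIIIMeasure_eq_map hb,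
    Measure.map_map (by fun_prop) (by fun_prop), Function.comp_def]

theorem isOpen_logPearsonIIIRange : IsOpen (logPearsonIIIRange b m) := by
  unfold logPearsonIIIRange
  split_ifs
  exacts [isOpen_Ioi, isOpen_Ioo]

theorem pos_of_mem_logPearsonIIIRange (h : y ∈ logPearsonIIIRange b m) : 0 < y := by
  unfold logPearsonIIIRange at h
  split_ifs at h
  exacts [(Real.exp_pos m).trans h, h.1]

theorem exp_mem_logPearsonIIIRange {x : ℝ} :
    Real.exp x ∈ logPearsonIIIRange b m ↔ x ∈ pearsonIIIRange b m := by
  unfold logPearsonIIIRange pearsonIIIRange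
  split_ifs <;> simp [Real.exp_pos]

theorem mul_log_sub_pos_of_mem_logPearsonIIIRange (hb : b ≠ 0) (hy : y ∈ logPearsonIIIRange b m) :
    0 < b * (Real.log y - m) := by
  refine mul_sub_pos_of_mem_pearsonIIIRange hb (exp_mem_logPearsonIIIRange.1 ?_)
  rwa [Real.exp_log (pos_of_mem_logPearsonIIIRange hy)]

theorem logPearsonIIIPDF_nonneg (ha : 0 < a) (hb : b ≠ 0) : 0 ≤ logPearsonIIIPDF a b m y := by
  refine Set.indicator_nonneg (fun y hy => ?_) y
  have := pos_of_mem_logPearsonIIIRange hy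
  have := mul_log_sub_pos_of_mem_logPearsonIIIRange hb hy
  positivity

theorem measurable_logPearsonIIIPDF : Measurable (logPearsonIIIPDF a b m) :=
  Measurable.indicator (by fun_prop) isOpen_logPearsonIIIRange.measurableSet

theorem logPearsonIIIPDF_eq_zero_of_mem (hy : y ∈ ({0, Real.exp m} : Set ℝ)) :
    logPearsonIIIPDF a b m y = 0 := by
  refine Set.indicator_of_notMem ?_ _
  unfold logPearsonIIIRange
  rcases hy with rfl | rfl <;> split_ifs <;> simp [(Real.exp_pos m).le]

theorem closure_logPearsonIIIRange_subset :
    closure (logPearsonIIIRange b m) ⊆ logPearsonIIIRange b m ∪ {0, Real.exp m} := by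
  rw [closure_eq_self_union_frontier]
  refine Set.union_subset_union_right _ ?_
  unfold logPearsonIIIRange
  split_ifs
  · simp
  · rw [frontier_Ioo (Real.exp_pos m)]

theorem continuousAt_logPearsonIIIPDF (hb : b ≠ 0) (hy : y ∉ ({0, Real.exp m} : Set ℝ)) :
    ContinuousAt (logPearsonIIIPDF a b m) y := by
  by_cases hmem : y ∈ logPearsonIIIRange b m
  · refine ContinuousAt.congr ?_
      (Set.eqOn_indicator.eventuallyEq_of_mem (isOpen_logPearsonIIIRange.mem_nhds hmem)).symm
    have hy0 : y ≠ 0 := (pos_of_mem_logPearsonIIIRange hmem).ne'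
    have hbase : b * (Real.log y - m) ≠ 0 := (mul_log_sub_pos_of_mem_logPearsonIIIRange hb hmem).ne'
    exact (continuousAt_const.mul ((continuousAt_const.mul
      ((Real.continuousAt_log hy0).sub continuousAt_const)).rpow_const (Or.inl hbase))).mul
      (continuousAt_id.rpow_const (Or.inl hy0))
  · refine (continuousAt_const (y := (0 : ℝ))).congr ?_
    have hclosure : y ∉ closure (logPearsonIIIRange b m) := fun h =>
      (closure_logPearsonIIIRange_subset h).elim hmem hy
    filter_upwards [isClosed_closure.isOpen_compl.mem_nhds hclosure] with z hz
    exact (Set.indicator_of_notMem (mt (subset_closure ·) hz) _).symm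

theorem exp_mul_logPearsonIIIPDF_exp (x : ℝ) :
    Real.exp x * logPearsonIIIPDF a b m (Real.exp x) = pearsonIIIPDF a b m x := by
  unfold logPearsonIIIPDF pearsonIIIPDF
  by_cases h : x ∈ pearsonIIIRange b m
  · have hexp : Real.exp (-(b * (x - m))) =
        Real.exp x * Real.exp (b * m) * Real.exp (x * (-b - 1)) := by
      rw [← Real.exp_add, ← Real.exp_add]
      ring_nf
    rw [Set.indicator_of_mem h, Set.indicator_of_mem (exp_mem_logPearsonIIIRange.2 h), Real.log_exp,
      ← Real.exp_mul, hexp]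
    ring
  · rw [Set.indicator_of_notMem h, Set.indicator_of_notMem (mt exp_mem_logPearsonIIIRange.1 h),
      mul_zero]

theorem logPearsonIIIMeasure_eq_withDensity :
    logPearsonIIIMeasure a b m =
      volume.withDensity fun y => ENNReal.ofReal (logPearsonIIIPDF a b m y) := by
  refine map_withDensity_of_hasDerivAt Real.exp_injective Real.hasDerivAt_exp
    (Filter.Eventually.of_forall fun x => ?_) fun y hy => ?_
  · simp only [Real.abs_exp, ← ENNReal.ofReal_mul (Real.exp_pos x).le,
      exp_mul_logPearsonIIIPDF_exp]
  · rw [Real.range_exp] at hy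
    rw [logPearsonIIIPDF, Set.indicator_of_notMem (mt pos_of_mem_logPearsonIIIRange hy),
      ENNReal.ofReal_zero]

theorem logPearsonIIICDF_of_nonpos (hy : y ≤ 0) : logPearsonIIICDF a b m y = 0 := by
  rw [logPearsonIIICDF, if_neg fun h => hy.not_gt (pos_of_mem_logPearsonIIIRange h), if_pos hy,
    ite_self]

theorem logPearsonIIICDF_exp_of_pos (hb : 0 < b) (x : ℝ) :
    logPearsonIIICDF a b m (Real.exp x) = lowerIncGamma a (b * (x - m)) / Real.Gamma a := by
  simp only [logPearsonIIICDF, exp_mem_logPearsonIIIRange, pearsonIIIRange, if_pos hb, Set.mem_Ioi,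
    Real.log_exp]
  split_ifs with hx
  · rfl
  · have hempty := mul_nonpos_of_nonneg_of_nonpos hb.le (sub_nonpos.2 (not_lt.1 hx))
    rw [lowerIncGamma, Set.Ioc_eq_empty hempty.not_gt, setIntegral_empty, zero_div]

theorem logPearsonIIICDF_exp_of_neg (ha : 0 < a) (hb : b < 0) (x : ℝ) :
    logPearsonIIICDF a b m (Real.exp x) =
      upperIncGamma a (max 0 (b * (x - m))) / Real.Gamma a := by
  simp only [logPearsonIIICDF, exp_mem_logPearsonIIIRange, pearsonIIIRange, if_neg hb.not_gt,
    Set.mem_Iio, Real.log_exp, if_neg (Real.exp_pos x).not_ge]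
  split_ifs with hx
  · rw [max_eq_right (mul_pos_of_neg_of_neg hb (sub_neg.2 hx)).le]
  · have hGamma : upperIncGamma a 0 = Real.Gamma a := by
      simp only [upperIncGamma, Real.Gamma_eq_integral ha, mul_comm]
    rw [max_eq_left (mul_nonpos_of_nonpos_of_nonneg hb.le (sub_nonneg.2 (not_lt.1 hx))), hGamma,
      div_self (Real.Gamma_pos_of_pos ha).ne']

theorem logPearsonIIIMeasure_real_Iic (ha : 0 < a) (hb : b ≠ 0) (y : ℝ) :
    (logPearsonIIIMeasure a b m).real (Set.Iic y) = logPearsonIIICDF a b m y := by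
  rw [logPearsonIIIMeasure_eq_map hb, map_measureReal_apply (by fun_prop) measurableSet_Iic]
  rcases le_or_gt y 0 with hy | hy
  · have hempty : (fun t => Real.exp (m + t / b)) ⁻¹' Set.Iic y = ∅ :=
      Set.eq_empty_of_forall_notMem fun t => (hy.trans_lt (Real.exp_pos _)).not_ge
    rw [hempty, measureReal_empty, logPearsonIIICDF_of_nonpos hy]
  obtain ⟨x, rfl⟩ : ∃ x, Real.exp x = y := ⟨Real.log y, Real.exp_log hy⟩
  rcases lt_or_gt_of_ne hb with hb | hb
  · have hpreimage : (fun t => Real.exp (m + t / b)) ⁻¹' Set.Iic (Real.exp x) =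
        Set.Ici (b * (x - m)) := by
      ext t
      rw [Set.mem_preimage, Set.mem_Iic, Real.exp_le_exp, Set.mem_Ici, ← le_sub_iff_add_le',
        div_le_iff_of_neg' hb]
    rw [hpreimage, gammaMeasure_one_real_Ici ha, logPearsonIIICDF_exp_of_neg ha hb]
  · have hpreimage : (fun t => Real.exp (m + t / b)) ⁻¹' Set.Iic (Real.exp x) =
        Set.Iic (b * (x - m)) := by
      ext t
      rw [Set.mem_preimage, Set.mem_Iic, Real.exp_le_exp, Set.mem_Iic, ← le_sub_iff_add_le',
        div_le_iff₀' hb]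
    rw [hpreimage, gammaMeasure_one_real_Iic ha, logPearsonIIICDF_exp_of_pos hb]

theorem exp_add_div_pow (m t b : ℝ) (n : ℕ) :
    Real.exp (m + t / b) ^ n = Real.exp (m * n) * Real.exp (n / b * t) := by
  rw [← Real.exp_nat_mul, ← Real.exp_add]
  ring_nf

theorem div_lt_one_iff_neg_or_lt {c : ℝ} (hb : b ≠ 0) (hc : 0 ≤ c) :
    c / b < 1 ↔ b < 0 ∨ c < b := by
  rcases lt_or_gt_of_ne hb with h | h
  · simp [h, (div_nonpos_of_nonneg_of_nonpos hc h.le).trans_lt one_pos]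
  · simp [h.not_gt, div_lt_one h]

theorem integrable_pow_logPearsonIIIMeasure_iff (ha : 0 < a) (hb : b ≠ 0) {n : ℕ} :
    Integrable (· ^ n) (logPearsonIIIMeasure a b m) ↔ b < 0 ∨ (n : ℝ) < b := by
  have hexp := Set.ext_iff.1 (integrableExpSet_id_gammaMeasure ha one_pos) (n / b)
  rw [logPearsonIIIMeasure_eq_map hb, integrable_map_measure (by fun_prop) (by fun_prop),
    ← div_lt_one_iff_neg_or_lt hb n.cast_nonneg, ← Set.mem_Iio, ← hexp]
  simp only [Function.comp_def, exp_add_div_pow]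
  exact integrable_const_mul_iff (Real.exp_pos (m * n)).ne'.isUnit _

theorem integral_pow_logPearsonIIIMeasure (ha : 0 < a) (hb : b ≠ 0) {n : ℕ}
    (hn : b < 0 ∨ (n : ℝ) < b) :
    ∫ y, y ^ n ∂(logPearsonIIIMeasure a b m) = logPearsonIIIMoment n a b m := by
  have hmgf := mgf_id_gammaMeasure ha one_pos ((div_lt_one_iff_neg_or_lt hb n.cast_nonneg).2 hn)
  rw [logPearsonIIIMeasure_eq_map hb, integral_map (by fun_prop) (by fun_prop)]
  simp only [exp_add_div_pow]
  rw [integral_const_mul, logPearsonIIIMoment, ← one_div_div _ b, sub_div, div_self hb, ← hmgf]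
  rfl

end LogPearsonIII

section SignedMixtures

variable {α ι : Type*} [MeasurableSpace α] [Fintype ι]

/-- `IsSignedMixture μ c ν` says that `μ = ∑ i, c i • ν i` with real weights `c i` of either sign.
The terms with negative weights are moved to the left-hand side, so that the identity is one
between positive measures. -/
def IsSignedMixture (μ : Measure α) (c : ι → ℝ) (ν : ι → Measure α) : Prop :=
  μ + ∑ i, (-c i).toNNReal • ν i = ∑ i, (c i).toNNReal • ν i

theorem integral_sum_smul_measure {E : Type*} [NormedAddCommGroup E] [NormedSpace ℝ E]
    {ν : ι → Measure α} {f : α → E} (hf : ∀ i, Integrable f (ν i)) (w : ι → NNReal) :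
    ∫ x, f x ∂(∑ i, w i • ν i) = ∑ i, w i • ∫ x, f x ∂(ν i) := by
  rw [integral_finsetSum_measure fun i _ => (hf i).smul_measure_nnreal]
  simp only [integral_smul_nnreal_measure]

theorem toNNReal_smul_eq_add {E : Type*} [AddCommGroup E] [Module ℝ E] (c : ℝ) (v : E) :
    c.toNNReal • v = c • v + (-c).toNNReal • v := by
  rw [NNReal.smul_def, NNReal.smul_def, ← add_smul, Real.coe_toNNReal', Real.coe_toNNReal']
  congr 1
  rcases le_total 0 c with hc | hc <;> simp [hc]

namespace IsSignedMixture

variable {μ : Measure α} {c : ι → ℝ} {ν : ι → Measure α}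

theorem integrable {E : Type*} [NormedAddCommGroup E] (h : IsSignedMixture μ c ν) {f : α → E}
    (hf : ∀ i, Integrable f (ν i)) : Integrable f μ :=
  (integrable_finsetSum_measure.2 fun i _ => (hf i).smul_measure_nnreal).mono_measure
    ((le_add_of_nonneg_right bot_le).trans_eq h)

theorem integral_eq {E : Type*} [NormedAddCommGroup E] [NormedSpace ℝ E]
    (h : IsSignedMixture μ c ν) {f : α → E} (hf : ∀ i, Integrable f (ν i)) :
    ∫ x, f x ∂μ = ∑ i, c i • ∫ x, f x ∂(ν i) := by
  have hsum := congrArg (fun ρ => ∫ x, f x ∂ρ) h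
  rw [integral_add_measure (h.integrable hf)
      (integrable_finsetSum_measure.2 fun i _ => (hf i).smul_measure_nnreal),
    integral_sum_smul_measure hf, integral_sum_smul_measure hf] at hsum
  simpa only [toNNReal_smul_eq_add (c _), Finset.sum_add_distrib, add_left_inj] using hsum

theorem measureReal_eq [∀ i, IsFiniteMeasure (ν i)] (h : IsSignedMixture μ c ν) {s : Set α}
    (hs : MeasurableSet s) :
    μ.real s = ∑ i, c i * (ν i).real s := by
  simpa only [integral_indicator_one hs, smul_eq_mul] using
    h.integral_eq (f := s.indicator (1 : α → ℝ)) fun _ => (integrable_const 1).indicator hs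

theorem map {β : Type*} [MeasurableSpace β] (h : IsSignedMixture μ c ν) {f : α → β}
    (hf : Measurable f) : IsSignedMixture (μ.map f) c fun i => (ν i).map f := by
  have hmap := congrArg (Measure.map f) h
  rw [Measure.map_add _ _ hf, Measure.map_finset_sum' hf.aemeasurable,
    Measure.map_finset_sum' hf.aemeasurable] at hmap
  simpa only [IsSignedMixture, Measure.map_smul] using hmap

theorem ae_nonneg_and_eq_withDensity [IsFiniteMeasure μ] {ρ : Measure α} {f : ι → α → ℝ}
    (hf : ∀ i, Integrable (f i) ρ) (hf0 : ∀ i x, 0 ≤ f i x)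
    (h : IsSignedMixture μ c fun i => ρ.withDensity fun x => ENNReal.ofReal (f i x)) :
    (∀ᵐ x ∂ρ, 0 ≤ ∑ i, c i * f i x) ∧
      μ = ρ.withDensity fun x => ENNReal.ofReal (∑ i, c i * f i x) := by
  have (i : ι) : IsFiniteMeasure (ρ.withDensity fun x => ENNReal.ofReal (f i x)) :=
    isFiniteMeasure_withDensity_ofReal (hf i).2
  have hsum : Integrable (fun x => ∑ i, c i * f i x) ρ :=
    integrable_finsetSum _ fun i _ => (hf i).const_mul _
  have hset (s : Set α) (hs : MeasurableSet s) : ∫ x in s, ∑ i, c i * f i x ∂ρ = μ.real s := by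
    rw [h.measureReal_eq hs, integral_finsetSum _ fun i _ => ((hf i).const_mul _).integrableOn]
    refine Finset.sum_congr rfl fun i _ => ?_
    rw [integral_const_mul, measureReal_def, withDensity_apply _ hs,
      integral_eq_lintegral_of_nonneg_ae (Filter.Eventually.of_forall (hf0 i))
        (hf i).aestronglyMeasurable.restrict]
  have hnonneg : ∀ᵐ x ∂ρ, 0 ≤ ∑ i, c i * f i x :=
    ae_nonneg_of_forall_setIntegral_nonneg hsum fun s hs _ =>
      (hset s hs).symm ▸ measureReal_nonneg
  refine ⟨hnonneg, Measure.ext fun s hs => ?_⟩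
  rw [withDensity_apply _ hs, ← ofReal_integral_eq_lintegral_ofReal hsum.integrableOn
    (ae_restrict_of_ae hnonneg), hset s hs, ofReal_measureReal]

end IsSignedMixture

theorem isSignedMixture_of_charFun {E : Type*} [NormedAddCommGroup E] [InnerProductSpace ℝ E]
    [CompleteSpace E] [SecondCountableTopology E] [MeasurableSpace E] [BorelSpace E]
    {μ : Measure E} [IsFiniteMeasure μ] {c : ι → ℝ} {ν : ι → Measure E}
    [∀ i, IsFiniteMeasure (ν i)] (h : ∀ t, charFun μ t = ∑ i, c i * charFun (ν i) t) :
    IsSignedMixture μ c ν := by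
  have hchar (t : E) (ρ : Measure E) [IsFiniteMeasure ρ] :
      Integrable (BoundedContinuousFunction.innerProbChar t) ρ :=
    BoundedContinuousFunction.integrable ρ _
  refine Measure.ext_of_charFun (funext fun t => ?_)
  have ht := h t
  simp only [charFun_eq_integral_innerProbChar] at ht ⊢
  rw [integral_add_measure (hchar t μ) (hchar t _),
    integral_sum_smul_measure fun i => hchar t (ν i),
    integral_sum_smul_measure fun i => hchar t (ν i), ht]
  simp only [toNNReal_smul_eq_add (c _), Finset.sum_add_distrib, Complex.real_smul]

theorem nonneg_of_ae_nonneg_of_continuousAt [TopologicalSpace α] {ρ : Measure α}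
    [ρ.IsOpenPosMeasure] {f : α → ℝ} (h : ∀ᵐ x ∂ρ, 0 ≤ f x) {x : α} (hx : ContinuousAt f x) :
    0 ≤ f x :=
  ge_of_tendsto_of_frequently hx
    (mem_closure_iff_frequently.1 (Measure.dense_of_ae h x))

end SignedMixtures

section LogPearsonIIIMixtures

variable {ι : Type*} [Fintype ι] {μ : Measure ℝ} {c a b : ι → ℝ} {m : ℝ}

theorem cdf_logPearsonIIIMeasure {a b : ℝ} (ha : 0 < a) (hb : b ≠ 0) (y : ℝ) :
    cdf (logPearsonIIIMeasure a b m) y = logPearsonIIICDF a b m y := by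
  have := isProbabilityMeasure_logPearsonIIIMeasure (m := m) ha hb
  rw [cdf_eq_real, logPearsonIIIMeasure_real_Iic ha hb]

theorem integrable_logPearsonIIIPDF {a b : ℝ} (ha : 0 < a) (hb : b ≠ 0) :
    Integrable (logPearsonIIIPDF a b m) := by
  have := isProbabilityMeasure_logPearsonIIIMeasure (m := m) ha hb
  have hmass := measure_ne_top (logPearsonIIIMeasure a b m) Set.univ
  rw [logPearsonIIIMeasure_eq_withDensity, withDensity_apply _ MeasurableSet.univ,
    Measure.restrict_univ] at hmass
  exact (lintegral_ofReal_ne_top_iff_integrable measurable_logPearsonIIIPDF.aestronglyMeasurable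
    (Filter.Eventually.of_forall fun _ => logPearsonIIIPDF_nonneg ha hb)).1 hmass

theorem integral_pow_eq_sum_logPearsonIIIMoment (ha : ∀ i, 0 < a i) (hb : ∀ i, b i ≠ 0)
    (h : IsSignedMixture μ c fun i => logPearsonIIIMeasure (a i) (b i) m) {n : ℕ}
    (hn : ∀ i, b i < 0 ∨ (n : ℝ) < b i) :
    ∫ y, y ^ n ∂μ = ∑ i, c i * logPearsonIIIMoment n (a i) (b i) m := by
  have hpow (i : ι) := (integrable_pow_logPearsonIIIMeasure_iff (m := m) (ha i) (hb i)).2 (hn i)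
  simp only [h.integral_eq hpow, smul_eq_mul,
    integral_pow_logPearsonIIIMeasure (ha _) (hb _) (hn _)]

variable [IsProbabilityMeasure μ]

theorem cdf_eq_sum_logPearsonIIICDF (ha : ∀ i, 0 < a i) (hb : ∀ i, b i ≠ 0)
    (h : IsSignedMixture μ c fun i => logPearsonIIIMeasure (a i) (b i) m) (y : ℝ) :
    cdf μ y = ∑ i, c i * logPearsonIIICDF (a i) (b i) m y := by
  have (i : ι) := isProbabilityMeasure_logPearsonIIIMeasure (m := m) (ha i) (hb i)
  simp only [cdf_eq_real, h.measureReal_eq measurableSet_Iic,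
    logPearsonIIIMeasure_real_Iic (ha _) (hb _)]

theorem ae_nonneg_and_eq_withDensity_sum_logPearsonIIIPDF (ha : ∀ i, 0 < a i)
    (hb : ∀ i, b i ≠ 0) (h : IsSignedMixture μ c fun i => logPearsonIIIMeasure (a i) (b i) m) :
    (∀ᵐ y, 0 ≤ ∑ i, c i * logPearsonIIIPDF (a i) (b i) m y) ∧
      μ = volume.withDensity fun y =>
        ENNReal.ofReal (∑ i, c i * logPearsonIIIPDF (a i) (b i) m y) := by
  simp only [logPearsonIIIMeasure_eq_withDensity] at h
  exact h.ae_nonneg_and_eq_withDensity (fun i => integrable_logPearsonIIIPDF (ha i) (hb i))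
    fun i _ => logPearsonIIIPDF_nonneg (ha i) (hb i)

theorem sum_mul_logPearsonIIIPDF_nonneg (ha : ∀ i, 0 < a i) (hb : ∀ i, b i ≠ 0)
    (h : IsSignedMixture μ c fun i => logPearsonIIIMeasure (a i) (b i) m) (y : ℝ) :
    0 ≤ ∑ i, c i * logPearsonIIIPDF (a i) (b i) m y := by
  by_cases hy : y ∈ ({0, Real.exp m} : Set ℝ)
  · simp only [logPearsonIIIPDF_eq_zero_of_mem hy, mul_zero, Finset.sum_const_zero, le_refl]
  · exact nonneg_of_ae_nonneg_of_continuousAt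
      (ae_nonneg_and_eq_withDensity_sum_logPearsonIIIPDF ha hb h).1
      (tendsto_finsetSum _ fun i _ =>
        continuousAt_const.mul (continuousAt_logPearsonIIIPDF (hb i) hy))

variable {Ω : Type*} [MeasurableSpace Ω] {P : Measure Ω} {Z : Ω → ℝ}

theorem isDensityOf_logPearsonIIIPDF {a b : ℝ} (ha : 0 < a) (hb : b ≠ 0)
    (hZ : HasLaw Z (logPearsonIIIMeasure a b m) P) :
    IsDensityOf (logPearsonIIIPDF a b m) Z P where
  measurable := measurable_logPearsonIIIPDF
  nonneg _ := logPearsonIIIPDF_nonneg ha hb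
  hasLaw := logPearsonIIIMeasure_eq_withDensity ▸ hZ

theorem isDensityOf_sum_logPearsonIIIPDF (ha : ∀ i, 0 < a i) (hb : ∀ i, b i ≠ 0)
    (h : IsSignedMixture μ c fun i => logPearsonIIIMeasure (a i) (b i) m) (hZ : HasLaw Z μ P) :
    IsDensityOf (fun y => ∑ i, c i * logPearsonIIIPDF (a i) (b i) m y) Z P where
  measurable := Finset.measurable_fun_sum _ fun _ _ => measurable_logPearsonIIIPDF.const_mul _
  nonneg := sum_mul_logPearsonIIIPDF_nonneg ha hb h
  hasLaw := (ae_nonneg_and_eq_withDensity_sum_logPearsonIIIPDF ha hb h).2 ▸ hZ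

end LogPearsonIIIMixtures

section IndependentSums

variable {Ω ι : Type*} [MeasurableSpace Ω] {P : Measure Ω}

theorem lintegral_prod_of_iIndepFun (s : Finset ι) {Y : ι → Ω → ENNReal} (h : iIndepFun Y P)
    (hY : ∀ i, AEMeasurable (Y i) P) :
    ∫⁻ ω, ∏ i ∈ s, Y i ω ∂P = ∏ i ∈ s, ∫⁻ ω, Y i ω ∂P := by
  have hmk := lintegral_prod_eq_prod_lintegral_of_indepFun s (fun i => (hY i).mk (Y i))
    (h.congr fun i => (hY i).ae_eq_mk) fun i => (hY i).measurable_mk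
  have hae : ∀ᵐ ω ∂P, ∀ i ∈ s, Y i ω = (hY i).mk (Y i) ω :=
    (Finset.eventually_all s).2 fun i _ => (hY i).ae_eq_mk
  rw [lintegral_congr_ae (hae.mono fun ω hω => Finset.prod_congr rfl hω), hmk]
  exact Finset.prod_congr rfl fun i _ => lintegral_congr_ae (hY i).ae_eq_mk.symm

variable [Fintype ι]

theorem ofReal_ne_ofReal_mul_I {b : ℝ} (hb : b ≠ 0) (t : ℝ) : (b : ℂ) ≠ t * Complex.I := fun h =>
  hb (by simpa using congrArg Complex.re h)

theorem prod_cpow_eq_cpow_sum {z : ℂ} (hz : z ≠ 0) (a : ι → ℂ) : ∏ i, z ^ a i = z ^ ∑ i, a i := by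
  simp only [Complex.cpow_def_of_ne_zero hz, Finset.mul_sum, Complex.exp_sum]

variable {X : ι → Ω → ℝ} {a b m : ι → ℝ}

theorem charFun_sum_pearsonIII (ha : ∀ i, 0 < a i) (hb : ∀ i, b i ≠ 0)
    (hX : ∀ i, HasLaw (X i) (pearsonIIIMeasure (a i) (b i) (m i)) P) (hindep : iIndepFun X P)
    (t : ℝ) :
    charFun (P.map fun ω => ∑ i, X i ω) t =
      (∏ i, ((b i : ℂ) / (b i - t * Complex.I)) ^ (a i : ℂ)) *
        Complex.exp (t * (∑ i, m i : ℝ) * Complex.I) := by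
  rw [iIndepFun.charFun_map_fun_sum_eq_prod (fun i => (hX i).aemeasurable) hindep,
    Finset.prod_apply]
  simp only [(hX _).map_eq, charFun_pearsonIIIMeasure (ha _) (hb _)]
  rw [Finset.prod_mul_distrib, ← Complex.exp_sum, Complex.ofReal_sum, Finset.mul_sum,
    Finset.sum_mul]

variable [IsProbabilityMeasure P]

theorem integrable_prod_iff_of_iIndepFun {Y : ι → Ω → ℝ} (h : iIndepFun Y P)
    (hY : ∀ i, AEMeasurable (Y i) P) (hpos : ∀ i ω, 0 < Y i ω) :
    Integrable (fun ω => ∏ i, Y i ω) P ↔ ∀ i, Integrable (Y i) P := by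
  have hprod : AEMeasurable (fun ω => ∏ i, Y i ω) P :=
    Finset.aemeasurable_fun_prod _ fun i _ => hY i
  have hlintegral : ∫⁻ ω, ENNReal.ofReal (∏ i, Y i ω) ∂P =
      ∏ i, ∫⁻ ω, ENNReal.ofReal (Y i ω) ∂P := by
    simp only [ENNReal.ofReal_prod_of_nonneg fun i _ => (hpos i _).le]
    exact lintegral_prod_of_iIndepFun _ (h.comp _ fun _ => ENNReal.measurable_ofReal)
      fun i => (hY i).ennreal_ofReal
  have hne (i : ι) : ∫⁻ ω, ENNReal.ofReal (Y i ω) ∂P ≠ 0 := by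
    rw [Ne, lintegral_eq_zero_iff' (hY i).ennreal_ofReal]
    intro hzero
    obtain ⟨ω, hω⟩ := hzero.exists
    exact (ENNReal.ofReal_pos.2 (hpos i ω)).ne' hω
  rw [← lintegral_ofReal_ne_top_iff_integrable hprod.aestronglyMeasurable
    (Filter.Eventually.of_forall fun ω => Finset.prod_nonneg fun i _ => (hpos i ω).le), hlintegral]
  simp only [← fun i => lintegral_ofReal_ne_top_iff_integrable (hY i).aestronglyMeasurable
    (Filter.Eventually.of_forall fun ω => (hpos i ω).le)]
  exact ⟨fun hfin i hi => hfin (WithTop.prod_eq_top (Finset.mem_univ i) hi fun j _ => hne j),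
    fun hfin => ENNReal.prod_ne_top fun i _ => hfin i⟩

theorem integrable_exp_sum_pow_iff (ha : ∀ i, 0 < a i) (hb : ∀ i, b i ≠ 0)
    (hX : ∀ i, HasLaw (X i) (pearsonIIIMeasure (a i) (b i) (m i)) P) (hindep : iIndepFun X P)
    (n : ℕ) :
    Integrable (fun ω => Real.exp (∑ i, X i ω) ^ n) P ↔ ∀ i, b i < 0 ∨ (n : ℝ) < b i := by
  have hfactor (i : ι) :
      Integrable (fun ω => Real.exp (X i ω) ^ n) P ↔ b i < 0 ∨ (n : ℝ) < b i := by
    rw [← integrable_pow_logPearsonIIIMeasure_iff (ha i) (hb i), logPearsonIIIMeasure,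
      ← (hX i).map_eq, AEMeasurable.map_map_of_aemeasurable (by fun_prop) (hX i).aemeasurable,
      integrable_map_measure (by fun_prop) (by fun_prop)]
    rfl
  simp only [Real.exp_sum, ← Finset.prod_pow, ← hfactor]
  exact integrable_prod_iff_of_iIndepFun
    (hindep.comp (fun _ x => Real.exp x ^ n) fun _ => by fun_prop) (fun i => by fun_prop)
    fun i ω => by positivity

theorem hasLaw_exp_sum_pearsonIII_of_eq [Nonempty ι] {b₀ : ℝ} (ha : ∀ i, 0 < a i) (hb₀ : b₀ ≠ 0)
    (hX : ∀ i, HasLaw (X i) (pearsonIIIMeasure (a i) b₀ (m i)) P) (hindep : iIndepFun X P) :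
    HasLaw (fun ω => Real.exp (∑ i, X i ω))
      (logPearsonIIIMeasure (∑ i, a i) b₀ (∑ i, m i)) P := by
  have hsum : 0 < ∑ i, a i := Finset.sum_pos (fun i _ => ha i) Finset.univ_nonempty
  have := isProbabilityMeasure_pearsonIIIMeasure (m := ∑ i, m i) hsum hb₀
  refine HasLaw.fun_comp (μ := pearsonIIIMeasure (∑ i, a i) b₀ (∑ i, m i))
    ⟨by fun_prop, rfl⟩ ⟨by fun_prop, Measure.ext_of_charFun (funext fun t => ?_)⟩
  have hbase : (b₀ : ℂ) / (b₀ - t * Complex.I) ≠ 0 :=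
    div_ne_zero (Complex.ofReal_ne_zero.2 hb₀) (sub_ne_zero.2 (ofReal_ne_ofReal_mul_I hb₀ t))
  rw [charFun_sum_pearsonIII ha (fun _ => hb₀) hX hindep, charFun_pearsonIIIMeasure hsum hb₀,
    prod_cpow_eq_cpow_sum hbase, Complex.ofReal_sum Finset.univ a]

end IndependentSums

section DistinctRates

variable {N : ℕ} {a : Fin (N + 1) → ℕ} {b m : Fin (N + 1) → ℝ}

theorem cast_sigma_Icc_pos (p : Σ i, Finset.Icc 1 (a i)) : (0 : ℝ) < (p.2 : ℕ) :=
  Nat.cast_pos.2 (Finset.mem_Icc.1 p.2.2).1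

theorem sum_sigma_Icc {M : Type*} [AddCommMonoid M] (F : Fin (N + 1) → ℕ → M) :
    ∑ p : Σ i, Finset.Icc 1 (a i), F p.1 p.2 = ∑ i, ∑ k ∈ Finset.Icc 1 (a i), F i k := by
  rw [Fintype.sum_sigma]
  exact Finset.sum_congr rfl fun i _ => Finset.sum_coe_sort (Finset.Icc 1 (a i)) (F i)

theorem isSignedMixture_exp_sum_pearsonIII {Ω : Type*} [MeasurableSpace Ω] {P : Measure Ω}
    [IsProbabilityMeasure P] {X : Fin (N + 1) → Ω → ℝ} (ha : ∀ i, 0 < a i) (hb : ∀ i, b i ≠ 0)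
    (hX : ∀ i, HasLaw (X i) (pearsonIIIMeasure (a i) (b i) (m i)) P) (hindep : iIndepFun X P)
    (hinj : Function.Injective b) :
    IsSignedMixture (P.map fun ω => Real.exp (∑ i, X i ω))
      (fun p : Σ i, Finset.Icc 1 (a i) => Xi0 p.1 p.2 a b)
      fun p => logPearsonIIIMeasure (p.2 : ℕ) (b p.1) (∑ i, m i) := by
  have (p : Σ i, Finset.Icc 1 (a i)) :=
    isProbabilityMeasure_pearsonIIIMeasure (m := ∑ i, m i) (cast_sigma_Icc_pos p) (hb p.1)
  have := Measure.isProbabilityMeasure_map (μ := P) (f := fun ω => ∑ i, X i ω) (by fun_prop)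
  have hmap : P.map (fun ω => Real.exp (∑ i, X i ω)) = (P.map fun ω => ∑ i, X i ω).map Real.exp :=
    (AEMeasurable.map_map_of_aemeasurable Real.measurable_exp.aemeasurable
      (Finset.aemeasurable_fun_sum _ fun i _ => (hX i).aemeasurable)).symm
  rw [hmap]
  refine IsSignedMixture.map (isSignedMixture_of_charFun fun t => ?_) Real.measurable_exp
  have hfractions := prod_div_sub_pow_eq_sum_Xi0 (F := ℂ) ha hb hinj
    fun i => ofReal_ne_ofReal_mul_I (hb i) t
  simp only [Complex.coe_algebraMap] at hfractions
  rw [charFun_sum_pearsonIII (fun i => Nat.cast_pos.2 (ha i)) hb hX hindep]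
  simp only [Complex.ofReal_natCast, Complex.cpow_natCast, hfractions,
    charFun_pearsonIIIMeasure (cast_sigma_Icc_pos _) (hb _), ← mul_assoc, ← Finset.sum_mul]
  rw [sum_sigma_Icc fun i k => (Xi0 i k a b : ℂ) * ((b i : ℂ) / (b i - t * Complex.I)) ^ k]

end DistinctRates

theorem moment_eq_integral_pow_map {Ω : Type*} [MeasurableSpace Ω] {P : Measure Ω} {Z : Ω → ℝ}
    (hZ : AEMeasurable Z P) (n : ℕ) : moment Z n P = ∫ y, y ^ n ∂(P.map Z) := by
  rw [integral_map hZ (by fun_prop)]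
  rfl

theorem forall_neg_or_lt_iff {ι : Type*} {b : ι → ℝ} {c : ℝ}
    (hb : (∀ i, 0 < b i) ∨ ∀ i, b i < 0) :
    (∀ i, b i < 0 ∨ c < b i) ↔ (∀ i, b i < 0) ∨ ∀ i, c < b i := by
  refine ⟨fun h => ?_, fun h i => h.imp (· i) (· i)⟩
  exact hb.symm.imp_right fun hpos i => (h i).resolve_left (hpos i).not_gt

theorem mainTheorem12_general {Ω : Type*} [MeasurableSpace Ω] (P : Measure Ω)
    [IsProbabilityMeasure P] (N : ℕ) (X : Fin (N + 1) → Ω → ℝ) (a : Fin (N + 1) → ℕ)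
    (b m : Fin (N + 1) → ℝ) (ha : ∀ i, 0 < a i) (hb : ∀ i, b i ≠ 0)
    (hX : ∀ i, HasLaw (X i) (pearsonIIIMeasure (a i) (b i) (m i)) P)
    (hindep : iIndepFun X P)
    (SY : Ω → ℝ) (hSY : ∀ ω, SY ω = Real.exp (∑ i, X i ω)) :
    (∀ n : ℕ, Integrable (SY ^ n) P ↔ ∀ i, b i < 0 ∨ (n : ℝ) < b i) ∧
    (∀ b₀ : ℝ, (∀ i, b i = b₀) →
      (∀ y, cdf (P.map SY) y = logPearsonIIICDF (∑ i, a i : ℕ) b₀ (∑ i, m i) y) ∧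
      IsDensityOf (logPearsonIIIPDF (∑ i, a i : ℕ) b₀ (∑ i, m i)) SY P ∧
      (∀ n : ℕ, (b₀ < 0 ∨ (n : ℝ) < b₀) →
        moment SY n P = logPearsonIIIMoment n (∑ i, a i : ℕ) b₀ (∑ i, m i))) ∧
    ((∀ i j, i ≠ j → b i ≠ b j) →
      (∀ y, cdf (P.map SY) y =
        ∑ i, ∑ k ∈ Finset.Icc 1 (a i),
          Xi0 i k a b * logPearsonIIICDF k (b i) (∑ q, m q) y) ∧
      IsDensityOf
        (fun y => ∑ i, ∑ k ∈ Finset.Icc 1 (a i),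
          Xi0 i k a b * logPearsonIIIPDF k (b i) (∑ q, m q) y) SY P ∧
      (∀ n : ℕ, (∀ i, b i < 0 ∨ (n : ℝ) < b i) →
        moment SY n P =
          ∑ i, ∑ k ∈ Finset.Icc 1 (a i),
            Xi0 i k a b * logPearsonIIIMoment n k (b i) (∑ q, m q))) := by
  obtain rfl : SY = fun ω => Real.exp (∑ i, X i ω) := funext hSY
  have ha' (i : Fin (N + 1)) : (0 : ℝ) < a i := Nat.cast_pos.2 (ha i)
  have hmeas : AEMeasurable (fun ω => Real.exp (∑ i, X i ω)) P := by fun_prop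
  refine ⟨integrable_exp_sum_pow_iff ha' hb hX hindep, fun b₀ hb₀ => ?_, fun hdistinct => ?_⟩
  · obtain rfl : b = fun _ => b₀ := funext hb₀
    have hlaw := hasLaw_exp_sum_pearsonIII_of_eq ha' (hb 0) hX hindep
    have hsum : 0 < ∑ i, (a i : ℝ) := Finset.sum_pos (fun i _ => ha' i) Finset.univ_nonempty
    simp only [Nat.cast_sum, moment_eq_integral_pow_map hmeas, hlaw.map_eq]
    exact ⟨cdf_logPearsonIIIMeasure hsum (hb 0), isDensityOf_logPearsonIIIPDF hsum (hb 0) hlaw,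
      fun n hn => integral_pow_logPearsonIIIMeasure hsum (hb 0) hn⟩
  · have hmix := isSignedMixture_exp_sum_pearsonIII ha hb hX hindep
      fun i j => not_imp_not.1 (hdistinct i j)
    have := Measure.isProbabilityMeasure_map hmeas
    simp only [moment_eq_integral_pow_map hmeas, ← sum_sigma_Icc]
    exact ⟨cdf_eq_sum_logPearsonIIICDF cast_sigma_Icc_pos (fun p => hb p.1) hmix,
      isDensityOf_sum_logPearsonIIIPDF cast_sigma_Icc_pos (fun p => hb p.1) hmix ⟨hmeas, rfl⟩,
      fun n hn => integral_pow_eq_sum_logPearsonIIIMoment cast_sigma_Icc_pos (fun p => hb p.1) hmix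
        fun p => hn p.1⟩

theorem mainTheorem12 {Ω : Type*} [MeasurableSpace Ω] (P : Measure Ω) [IsProbabilityMeasure P]
    (N : ℕ) (X : Fin (N + 1) → Ω → ℝ) (a : Fin (N + 1) → ℕ) (b m : Fin (N + 1) → ℝ)
    (ha : ∀ i, 0 < a i)
    (hb : (∀ i, 0 < b i) ∨ (∀ i, b i < 0))
    (hX : ∀ i, HasLaw (X i) (pearsonIIIMeasure (a i) (b i) (m i)) P)
    (hindep : iIndepFun X P)
    (SY : Ω → ℝ) (hSY : ∀ ω, SY ω = Real.exp (∑ i, X i ω)) :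
    -- the moment of order `n` is finite for all `n` if the rates are negative,
    -- and exactly when every `b i` exceeds `n` if the rates are positive
    (∀ n : ℕ, Integrable (SY ^ n) P ↔ (∀ i, b i < 0) ∨ (∀ i, (n : ℝ) < b i)) ∧
    -- equal rates
    (∀ b₀ : ℝ, (∀ i, b i = b₀) →
      (∀ y, cdf (P.map SY) y = logPearsonIIICDF (∑ i, a i : ℕ) b₀ (∑ i, m i) y) ∧
      IsDensityOf (logPearsonIIIPDF (∑ i, a i : ℕ) b₀ (∑ i, m i)) SY P ∧
      (∀ n : ℕ, (b₀ < 0 ∨ (n : ℝ) < b₀) →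
        moment SY n P = logPearsonIIIMoment n (∑ i, a i : ℕ) b₀ (∑ i, m i))) ∧
    -- pairwise distinct rates
    ((∀ i j, i ≠ j → b i ≠ b j) →
      (∀ y, cdf (P.map SY) y =
        ∑ i, ∑ k ∈ Finset.Icc 1 (a i),
          Xi0 i k a b * logPearsonIIICDF k (b i) (∑ q, m q) y) ∧
      IsDensityOf
        (fun y => ∑ i, ∑ k ∈ Finset.Icc 1 (a i),
          Xi0 i k a b * logPearsonIIIPDF k (b i) (∑ q, m q) y) SY P ∧
      (∀ n : ℕ, ((∀ i, b i < 0) ∨ (∀ i, (n : ℝ) < b i)) →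
        moment SY n P =
          ∑ i, ∑ k ∈ Finset.Icc 1 (a i),
            Xi0 i k a b * logPearsonIIIMoment n k (b i) (∑ q, m q))) := by
  have hne (i : Fin (N + 1)) : b i ≠ 0 := hb.elim (fun h => (h i).ne') fun h => (h i).ne
  simpa only [forall_neg_or_lt_iff hb] using
    mainTheorem12_general P N X a b m ha hne hX hindep SY hSY
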